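/- Let $\Omega$ be a nonempty set, let $\mathbb{K}$ be a set of maps from $\mathbb{R}_+=[0,\infty)$ to $\Omega$ such that for every $\omega\in\Omega$ the set $\mathcal{L}(\omega)=\{z\in\mathbb{K}: z(0)=\omega\}$ is nonempty, and let $g:\Omega\to[0,1]$ be such that $t\mapsto g(z(t))$ is Borel measurable for each $z\in\mathbb{K}$. For $T,\lambda>0$ and $z\in\mathbb{K}$ put $$v_T(z)=\frac1T\int_0^T g(z(t))\,dt,\qquad w_\lambda(z)=\lambda\int_0^\infty e^{-\lambda t}g(z(t))\,dt,$$ and for $\omega\in\Omega$ put $\mathcal{V}_T(\omega)=\sup_{z\in\mathcal{L}(\omega)}v_T(z)$ and $\mathcal{W}_\lambda(\omega)=\sup_{z\in\mathcal{L}(\omega)}w_\lambda(z)$. Assume that both payoff families satisfy the Dynamic Programming Principle, that is, for all $\omega\in\Omega$, $$\mathcal{V}_T(\omega)=\sup_{z\in\mathcal{L}(\omega)}\Big[\frac1T\int_0^h g(z(t))\,dt+\frac{T-h}{T}\,\mathcal{V}_{T-h}(z(h))\Big]\quad\text{for all } T>0,\ h\in(0,T),$$ $$\mathcal{W}_\lambda(\omega)=\sup_{z\in\mathcal{L}(\omega)}\Big[\lambda\int_0^h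 e^{-\lambda t}g(z(t))\,dt+e^{-\lambda h}\,\mathcal{W}_\lambda(z(h))\Big]\quad\text{for all } \lambda>0,\ h>0.$$ Then the functions $\mathcal{V}_T$ converge uniformly on $\Omega$ as $T\uparrow\infty$ if and only if the functions $\mathcal{W}_\lambda$ converge uniformly on $\Omega$ as $\lambda\downarrow0$. Moreover, when at least one of these two statements holds, $$\lim_{T\uparrow\infty}\mathcal{V}_T(\omega)=\lim_{\lambda\downarrow0}\mathcal{W}_\lambda(\omega)\quad\text{for all }\omega\in\Omega.$$ -/

import Mathlib

open Set Filter Topology MeasureTheory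
open scoped NNReal

noncomputable section

namespace AbstractControl

variable {Ω : Type*}

/-- Time average `v_T(z) = (1/T) ∫_0^T g(z(t)) dt`. Processes are maps on `ℝ≥0`; the integration
variable is nonnegative, so that `t.toNNReal` is `t` itself. -/
def timeAverage (g : Ω → ℝ) (T : ℝ) (z : ℝ≥0 → Ω) : ℝ :=
  (1 / T) * ∫ t in (0 : ℝ)..T, g (z t.toNNReal)

/-- Discount average `w_lam(z) = lam ∫_0^∞ e^{-lam t} g(z(t)) dt`. -/
def discountAverage (g : Ω → ℝ) (lam : ℝ) (z : ℝ≥0 → Ω) : ℝ :=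
  lam * ∫ t in Ioi (0 : ℝ), Real.exp (-(lam * t)) * g (z t.toNNReal)

/-- Value function of the lower game with payoff `c`, where `proc ω l m` is the process generated
at `ω` by the rules `l` and `m`: `V[c](ω) = sup_l inf_m c(z[ω,l,m])`. -/
def lowerValue {K : Set (ℝ≥0 → Ω)} {L M : Ω → Type*} (proc : ∀ ω, L ω → M ω → K)
    (c : K → ℝ) (ω : Ω) : ℝ :=
  ⨆ l : L ω, ⨅ m : M ω, c (proc ω l m)

/-- The processes of `K` that begin at `ω`. -/
def feasible (K : Set (ℝ≥0 → Ω)) (ω : Ω) : Set K :=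
  {z | z.1 0 = ω}

/-- Value function of the abstract control system `K`: the lower game in which the first player
picks a feasible process and the second player's set of rules is a singleton. -/
def controlValue (K : Set (ℝ≥0 → Ω)) : (K → ℝ) → Ω → ℝ :=
  lowerValue (L := fun ω => feasible K ω) (M := fun _ => Unit) (fun _ l _ => l.1)

/-- The Dynamic Programming Principle for the family `v_T`, `T > 0`, where `V` assigns to each
payoff its value function. -/
def TimeDPP (K : Set (ℝ≥0 → Ω)) (V : (K → ℝ) → Ω → ℝ) (g : Ω → ℝ) : Prop :=
  ∀ T : ℝ, 0 < T → ∀ h ∈ Ioo 0 T,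
    V (fun z => timeAverage g T z.1) =
      V (fun z => (1 / T) * (∫ t in (0 : ℝ)..h, g (z.1 t.toNNReal)) +
        ((T - h) / T) * V (fun z' => timeAverage g (T - h) z'.1) (z.1 h.toNNReal))

/-- The Dynamic Programming Principle for the family `w_lam`, `lam > 0`. -/
def DiscountDPP (K : Set (ℝ≥0 → Ω)) (V : (K → ℝ) → Ω → ℝ) (g : Ω → ℝ) : Prop :=
  ∀ lam : ℝ, 0 < lam → ∀ h : ℝ, 0 < h →
    V (fun z => discountAverage g lam z.1) =
      V (fun z => lam * (∫ t in (0 : ℝ)..h, Real.exp (-(lam * t)) * g (z.1 t.toNNReal)) +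
        Real.exp (-(lam * h)) * V (fun z' => discountAverage g lam z'.1) (z.1 h.toNNReal))

/-- `sup_{z ∈ L(ω)} v_T(z)`. -/
def optTime (K : Set (ℝ≥0 → Ω)) (g : Ω → ℝ) (T : ℝ) (ω : Ω) : ℝ :=
  ⨆ z : feasible K ω, timeAverage g T z.1.1

/-- `sup_{z ∈ L(ω)} w_lam(z)`. -/
def optDiscount (K : Set (ℝ≥0 → Ω)) (g : Ω → ℝ) (lam : ℝ) (ω : Ω) : ℝ :=
  ⨆ z : feasible K ω, discountAverage g lam z.1.1

end AbstractControl

end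

namespace AbstractControl

/-! Both principles act on the same pairs (payoff `a` up to time `h`, state `y` at time `h`). Let
one family converge uniformly to `U`. A step that is nearly optimal for one family is a competitor
for the other. With `lam * h = b` and the horizon chosen suitably, `a` and the continuation value
carry matching weights in both inequalities, so `a` cancels. What remains says that a uniform
one-sided error `δ` of the other family from `U` becomes at most `(1 - b/2) * δ + O(b^2)`,
uniformity being needed because `y` is arbitrary. Finitely many iterations from `δ = 1` leave an
error `O(b)`, and `b` is arbitrary. The four `_step` lemmas treat both families and both signs;
`of_affine_contraction` iterates them. -/

/-- The pairs (accumulated payoff on `[0, h]`, state at time `h`) reachable from `ω`. -/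
def reachable {Ω : Type*} (K : Set (ℝ≥0 → Ω)) (g : Ω → ℝ) (h : ℝ) (ω : Ω) : Set (ℝ × Ω) :=
  {p | ∃ z ∈ K, z 0 = ω ∧ p = (∫ t in (0 : ℝ)..h, g (z t.toNNReal), z h.toNNReal)}

/-- The dynamic programming inequalities shared by the two families of value functions; the
discounted running payoff is replaced by its bounds in terms of the undiscounted one. -/
structure DynamicProgramming {Ω : Type*} (R : ℝ → Ω → Set (ℝ × Ω)) (V W : ℝ → Ω → ℝ) : Prop where
  time_mem : ∀ T, 0 < T → ∀ ω, V T ω ∈ Icc (0 : ℝ) 1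
  discount_mem : ∀ l, 0 < l → ∀ ω, W l ω ∈ Icc (0 : ℝ) 1
  time_ge : ∀ S h, 0 < S → 0 < h → ∀ ω, ∀ p ∈ R h ω,
    p.1 + S * V S p.2 ≤ (S + h) * V (S + h) ω
  time_le : ∀ S h η, 0 < S → 0 < h → 0 < η → ∀ ω, ∃ p ∈ R h ω,
    (S + h) * V (S + h) ω ≤ p.1 + S * V S p.2 + η
  discount_ge : ∀ l h, 0 < l → 0 < h → ∀ ω, ∀ p ∈ R h ω,
    Real.exp (-(l * h)) * (l * p.1 + W l p.2) ≤ W l ω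
  discount_le : ∀ l h η, 0 < l → 0 < h → 0 < η → ∀ ω, ∃ p ∈ R h ω,
    W l ω ≤ l * p.1 + Real.exp (-(l * h)) * W l p.2 + η

section Exponential

variable {b : ℝ}

theorem one_add_mul_exp_neg_le_one : (1 + b) * Real.exp (-b) ≤ 1 := by
  have h1 := Real.add_one_le_exp b
  have h2 : Real.exp b * Real.exp (-b) = 1 := by rw [← Real.exp_add]; simp
  nlinarith [Real.exp_pos (-b)]

theorem exp_neg_le_one_sub_half (h0 : 0 < b) (h1 : b ≤ 1) : Real.exp (-b) ≤ 1 - b / 2 := by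
  nlinarith [one_add_mul_exp_neg_le_one (b := b)]

/-- Compare with `(1 + b) * (1 - b + b^2) = 1 + b^3`. -/
theorem exp_neg_le_quadratic (h0 : 0 < b) : Real.exp (-b) ≤ 1 - b + b ^ 2 := by
  have h3 : 0 < b ^ 3 := by positivity
  nlinarith [one_add_mul_exp_neg_le_one (b := b)]

theorem exp_le_quadratic (h0 : 0 < b) (h1 : b ≤ 1) : Real.exp b ≤ 1 + b + b ^ 2 := by
  have := abs_le.1 (Real.abs_exp_sub_one_sub_id_le (x := b) (by rw [abs_of_pos h0]; exact h1))
  linarith [this.2]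

end Exponential

/-! ### One-step error contraction -/

namespace DynamicProgramming

variable {Ω : Type*} {R : ℝ → Ω → Set (ℝ × Ω)} {V W : ℝ → Ω → ℝ} {U : Ω → ℝ} {b ε δ : ℝ}

theorem discount_upper_step (D : DynamicProgramming R V W) (hU : ∀ ω, U ω ∈ Icc (0 : ℝ) 1)
    (hb : 0 < b) (hb1 : b ≤ 1) (hε : 0 < ε) (hδ : 0 ≤ δ) {l : ℝ} (hl : 0 < l)
    (h1 : ∀ ω, U ω - ε ≤ V (Real.exp (-b) / l) ω)
    (h2 : ∀ ω, V ((Real.exp (-b) + b) / l) ω ≤ U ω + ε)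
    (h3 : ∀ ω, W l ω ≤ U ω + δ) (ω : Ω) :
    W l ω ≤ U ω + ((1 - b / 2) * δ + (b ^ 2 + 5 * ε)) := by
  have hE := Real.exp_pos (-b)
  obtain ⟨⟨a, y⟩, hp, hle⟩ := D.discount_le l (b / l) ε hl (by positivity) hε ω
  -- The horizon `exp (-b) / l` gives the continuation value the weight `exp (-b)` it has in the
  -- discounted inequality.
  have hge := D.time_ge (Real.exp (-b) / l) (b / l) (by positivity) (by positivity) ω _ hp
  have hlb : l * (b / l) = b := by field_simp
  rw [hlb] at hle
  rw [← add_div] at hge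
  dsimp only at hle hge
  have hE1 := exp_neg_le_one_sub_half hb hb1
  have hE2 := exp_neg_le_quadratic hb
  have hE3 := Real.add_one_le_exp (-b)
  set E := Real.exp (-b)
  have ha : l * a + E * V (E / l) y ≤ (E + b) * V ((E + b) / l) ω := by
    have := mul_le_mul_of_nonneg_left hge hl.le
    field_simp at this
    linarith
  have i1 := mul_le_mul_of_nonneg_left (h1 y) hE.le
  have i2 := mul_le_mul_of_nonneg_left (h2 ω) (by positivity : 0 ≤ E + b)
  have i3 := mul_le_mul_of_nonneg_left (h3 y) hE.le
  -- The weights sum to `E + b`, which exceeds 1 by at most `b^2`; hence the quadratic error.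
  have i4 := mul_le_mul_of_nonneg_left (hU ω).2 (by linarith : 0 ≤ E + b - 1)
  have i5 := mul_le_mul_of_nonneg_right hE1 hδ
  have i6 := mul_le_mul_of_nonneg_right (by linarith : 2 * E + b + 1 ≤ 5) hε.le
  linarith

theorem discount_lower_step (D : DynamicProgramming R V W) (hU : ∀ ω, U ω ∈ Icc (0 : ℝ) 1)
    (hb : 0 < b) (hb1 : b ≤ 1) (hε : 0 < ε) (hδ : 0 ≤ δ) {l : ℝ} (hl : 0 < l)
    (h1 : ∀ ω, V (1 / l) ω ≤ U ω + ε)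
    (h2 : ∀ ω, U ω - ε ≤ V ((1 + b) / l) ω)
    (h3 : ∀ ω, U ω - δ ≤ W l ω) (ω : Ω) :
    U ω - ((1 - b / 2) * δ + (b ^ 2 + 5 * ε)) ≤ W l ω := by
  have hE := Real.exp_pos (-b)
  -- In `discount_ge` the factor `exp (-b)` multiplies payoff and continuation alike, so the horizon
  -- `1 / l` matches their weights.
  obtain ⟨⟨a, y⟩, hp, hle⟩ := D.time_le (1 / l) (b / l) (ε / l) (by positivity) (by positivity)
    (by positivity) ω
  have hge := D.discount_ge l (b / l) hl (by positivity) ω _ hp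
  have hlb : l * (b / l) = b := by field_simp
  rw [hlb] at hge
  rw [← add_div] at hle
  dsimp only at hle hge
  have hE1 := exp_neg_le_one_sub_half hb hb1
  have hE2 := one_add_mul_exp_neg_le_one (b := b)
  have hE3 := Real.add_one_le_exp (-b)
  set E := Real.exp (-b)
  have ha : (1 + b) * V ((1 + b) / l) ω ≤ l * a + V (1 / l) y + ε := by
    have := mul_le_mul_of_nonneg_left hle hl.le
    field_simp at this
    linarith
  have i1 := mul_le_mul_of_nonneg_left (h2 ω) (by positivity : 0 ≤ 1 + b)
  have i2 : E * ((1 + b) * (U ω - ε) - 2 * ε - δ) ≤ E * (l * a + W l y) :=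
    mul_le_mul_of_nonneg_left (by linarith [h1 y, h3 y]) hE.le
  have i4 := mul_le_mul_of_nonneg_left (hU ω).2 (by linarith : 0 ≤ 1 - (1 + b) * E)
  have i5 := mul_le_mul_of_nonneg_right hE1 hδ
  have i6 := mul_le_mul_of_nonneg_right (by linarith : (1 + b) * E + 2 * E ≤ 5) hε.le
  have i7 := mul_le_mul_of_nonneg_left hE3 (by positivity : 0 ≤ 1 + b)
  linarith

theorem time_upper_step (D : DynamicProgramming R V W) (hU : ∀ ω, U ω ∈ Icc (0 : ℝ) 1)
    (hb : 0 < b) (hb1 : b ≤ 1) (hε : 0 < ε) (hδ : 0 ≤ δ) {S : ℝ} (hS : 0 < S)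
    (h1 : ∀ ω, W (1 / S) ω ≤ U ω + ε) (h2 : ∀ ω, U ω - ε ≤ W (1 / S) ω)
    (h3 : ∀ ω, V S ω ≤ U ω + δ) (ω : Ω) :
    V (S * (1 + b)) ω ≤ U ω + ((1 - b / 2) * δ + (b ^ 2 + 5 * ε)) := by
  have hF := Real.exp_pos b
  obtain ⟨⟨a, y⟩, hp, hle⟩ := D.time_le S (S * b) (S * ε) hS (by positivity) (by positivity) ω
  have hge := D.discount_ge (1 / S) (S * b) (by positivity) (by positivity) ω _ hp
  have hlb : 1 / S * (S * b) = b := by field_simp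
  have hT : S + S * b = S * (1 + b) := by ring
  rw [hlb] at hge
  rw [hT] at hle
  dsimp only at hle hge
  have hF1 := exp_le_quadratic hb hb1
  have hFE : Real.exp b * Real.exp (-b) = 1 := by rw [← Real.exp_add]; simp
  have hge' : a / S + W (1 / S) y ≤ Real.exp b * W (1 / S) ω := by
    have := mul_le_mul_of_nonneg_left hge hF.le
    rw [← mul_assoc, hFE] at this
    calc _ = 1 * (1 / S * a + W (1 / S) y) := by ring
      _ ≤ _ := this
  have ha : (1 + b) * V (S * (1 + b)) ω ≤ a / S + V S y + ε := by
    rw [← mul_le_mul_iff_right₀ hS]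
    calc _ = S * (1 + b) * V (S * (1 + b)) ω := by ring
      _ ≤ _ := hle
      _ = _ := by field_simp
  set F := Real.exp b
  have i1 := mul_le_mul_of_nonneg_left (h1 ω) hF.le
  have i2 := mul_le_mul_of_nonneg_right hF1 (hU ω).1
  have i3 : b ^ 2 * U ω ≤ b ^ 2 * 1 := mul_le_mul_of_nonneg_left (hU ω).2 (by positivity)
  have hbb : b ^ 2 ≤ b := by nlinarith
  have i4 := mul_le_mul_of_nonneg_right (by linarith : F + 2 ≤ 5 * (1 + b)) hε.le
  have i5 := mul_le_mul_of_nonneg_right (by linarith : 1 ≤ 1 + b / 2 - b ^ 2 / 2) hδ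
  have hb3 : 0 < b ^ 3 := by positivity
  have hpos : 0 < 1 + b := by positivity
  -- The contraction comes from dividing by `1 + b`: `1 / (1 + b) ≤ 1 - b / 2`.
  rw [← mul_le_mul_iff_right₀ hpos]
  linarith [h2 y, h3 y]

theorem time_lower_step (D : DynamicProgramming R V W) (hU : ∀ ω, U ω ∈ Icc (0 : ℝ) 1)
    (hb : 0 < b) (hb1 : b ≤ 1) (hε : 0 < ε) (hδ : 0 ≤ δ) {S : ℝ} (hS : 0 < S)
    (h1 : ∀ ω, W (Real.exp (-b) / S) ω ≤ U ω + ε)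
    (h2 : ∀ ω, U ω - ε ≤ W (Real.exp (-b) / S) ω)
    (h3 : ∀ ω, U ω - δ ≤ V S ω) (ω : Ω) :
    U ω - ((1 - b / 2) * δ + (b ^ 2 + 5 * ε)) ≤ V (S * (1 + b * Real.exp b)) ω := by
  have hF := Real.exp_pos b
  have hE := Real.exp_pos (-b)
  have hFE : Real.exp b * Real.exp (-b) = 1 := by rw [← Real.exp_add]; simp
  -- The rate `exp (-b) / S` makes the weights equal to `1 / S` and 1 after multiplication by `exp
  -- b`; the duration then follows from `lam * h = b`.
  have hlh : Real.exp (-b) / S * (S * (b * Real.exp b)) = b := by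
    field_simp
    linear_combination hFE
  obtain ⟨⟨a, y⟩, hp, hle⟩ := D.discount_le (Real.exp (-b) / S) (S * (b * Real.exp b)) ε
    (by positivity) (by positivity) hε ω
  have hge := D.time_ge S (S * (b * Real.exp b)) hS (by positivity) ω _ hp
  have hT : S + S * (b * Real.exp b) = S * (1 + b * Real.exp b) := by ring
  rw [hlh] at hle
  rw [hT] at hge
  dsimp only at hle hge
  have hE2 := exp_neg_le_quadratic hb
  have hE3 := Real.add_one_le_exp (-b)
  have hF1 := Real.add_one_le_exp b
  set F := Real.exp b
  set E := Real.exp (-b)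
  have hle' : F * W (E / S) ω ≤ a / S + W (E / S) y + F * ε := by
    calc _ ≤ F * (E / S * a + E * W (E / S) y + ε) := mul_le_mul_of_nonneg_left hle hF.le
      _ = F * E * (a / S + W (E / S) y) + F * ε := by ring
      _ = _ := by rw [hFE]; ring
  have ha : a / S + V S y ≤ (1 + b * F) * V (S * (1 + b * F)) ω := by
    rw [← mul_le_mul_iff_right₀ hS]
    calc _ = a + S * V S y := by field_simp
      _ ≤ _ := hge
      _ = _ := by ring
  have hF2 : F ≤ 1 + b * F := by
    have := mul_le_mul_of_nonneg_left hE3 hF.le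
    linarith
  have hF3 : 1 + b * F - F ≤ b ^ 2 * F := by
    have := mul_le_mul_of_nonneg_left hE2 hF.le
    linarith
  have i1 := mul_le_mul_of_nonneg_left (h2 ω) hF.le
  have i2 := mul_le_mul_of_nonneg_left (hU ω).2 (by linarith : 0 ≤ 1 + b * F - F)
  have i3 := mul_le_mul_of_nonneg_left hF2 (by positivity : 0 ≤ b ^ 2)
  have i4 := mul_le_mul_of_nonneg_right (by nlinarith : 2 * F + 1 ≤ 5 * (1 + b * F)) hε.le
  have i5 := mul_le_mul_of_nonneg_right
    (by nlinarith [mul_pos hb hb] : 1 ≤ (1 + b * F) * (1 - b / 2)) hδ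
  have hpos : 0 < 1 + b * F := by positivity
  rw [← mul_le_mul_iff_right₀ hpos]
  linarith [h1 y, h3 y]

end DynamicProgramming

/-! ### Iteration and uniform limits -/

/-- The affine map has fixed point `4 * b`. The number of iterations depends on `b` alone, so `P`
may be an "eventually" statement. -/
theorem of_affine_contraction {P : ℝ → Prop} {b : ℝ} (hb : 0 < b) (hb1 : b ≤ 1)
    (hmono : ∀ x y, x ≤ y → P x → P y) (h1 : P 1)
    (hstep : ∀ x, 0 ≤ x → P x → P ((1 - b / 2) * x + 2 * b ^ 2)) : P (5 * b) := by
  have hq : 0 ≤ 1 - b / 2 := by linarith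
  have key : ∀ n : ℕ, P ((1 - b / 2) ^ n + 4 * b) := by
    intro n
    induction n with
    | zero => exact hmono _ _ (by simp; linarith) h1
    | succ n ih => exact hmono _ _ (le_of_eq (by ring)) (hstep _ (by positivity) ih)
  obtain ⟨n, hn⟩ := exists_pow_lt_of_lt_one hb (by linarith : 1 - b / 2 < 1)
  exact hmono _ _ (by linarith) (key n)

section Uniform

variable {Ω ι : Type*} {l : Filter ι} {F : ι → Ω → ℝ} {U : Ω → ℝ}

theorem eventually_bounds (h : TendstoUniformly F U l) {ε : ℝ} (hε : 0 < ε) :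
    ∀ᶠ i in l, ∀ ω, F i ω ≤ U ω + ε ∧ U ω - ε ≤ F i ω := by
  filter_upwards [Metric.tendstoUniformly_iff.1 h ε hε] with i hi ω
  have := abs_lt.1 (Real.dist_eq _ _ ▸ hi ω)
  constructor <;> linarith [this.1, this.2]

theorem tendstoUniformly_of_bounds
    (hup : ∀ b : ℝ, 0 < b → b ≤ 1 → ∀ᶠ i in l, ∀ ω, F i ω ≤ U ω + 5 * b)
    (hlo : ∀ b : ℝ, 0 < b → b ≤ 1 → ∀ᶠ i in l, ∀ ω, U ω - 5 * b ≤ F i ω) :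
    TendstoUniformly F U l := by
  refine Metric.tendstoUniformly_iff.2 fun ε hε => ?_
  have hb : 0 < min 1 (ε / 6) := by positivity
  have hb' : min 1 (ε / 6) ≤ ε / 6 := min_le_right _ _
  filter_upwards [hup _ hb (min_le_left _ _), hlo _ hb (min_le_left _ _)] with i h1 h2 ω
  rw [Real.dist_eq, abs_lt]
  constructor <;> linarith [h1 ω, h2 ω]

theorem limit_mem_Icc [l.NeBot] (h : TendstoUniformly F U l)
    (hF : ∀ᶠ i in l, ∀ ω, F i ω ∈ Icc (0 : ℝ) 1) (ω : Ω) : U ω ∈ Icc (0 : ℝ) 1 :=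
  isClosed_Icc.mem_of_tendsto (h.tendsto_at ω) (hF.mono fun _ hi => hi ω)

end Uniform

theorem tendsto_const_div_nhdsGT_zero_atTop {c : ℝ} (hc : 0 < c) :
    Tendsto (fun l : ℝ => c / l) (𝓝[>] 0) atTop := by
  simpa [div_eq_mul_inv] using tendsto_inv_nhdsGT_zero.const_mul_atTop hc

theorem tendsto_const_div_atTop_nhdsGT_zero {c : ℝ} (hc : 0 < c) :
    Tendsto (fun T : ℝ => c / T) atTop (𝓝[>] 0) :=
  tendsto_nhdsWithin_iff.2 ⟨tendsto_const_nhds.div_atTop tendsto_id,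
    (eventually_gt_atTop 0).mono fun _ hT => div_pos hc hT⟩

/-! ### Transfer of the uniform limit -/

namespace DynamicProgramming

variable {Ω : Type*} {R : ℝ → Ω → Set (ℝ × Ω)} {V W : ℝ → Ω → ℝ} {U : Ω → ℝ}

theorem tendstoUniformly_discount (D : DynamicProgramming R V W)
    (hV : TendstoUniformly V U atTop) : TendstoUniformly W U (𝓝[>] 0) := by
  have hU := limit_mem_Icc hV ((eventually_gt_atTop 0).mono D.time_mem)
  have hpos : ∀ᶠ l : ℝ in 𝓝[>] 0, 0 < l := self_mem_nhdsWithin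
  refine tendstoUniformly_of_bounds (fun b hb hb1 => ?_) fun b hb hb1 => ?_
  -- This tolerance turns `b^2 + 5 * ε` into `2 * b^2`.
  · have hε : 0 < b ^ 2 / 5 := by positivity
    have hlim := eventually_bounds hV hε
    refine of_affine_contraction (P := fun δ => ∀ᶠ l in 𝓝[>] 0, ∀ ω, W l ω ≤ U ω + δ) hb hb1
      (fun x y hxy h => h.mono fun l hl ω => (hl ω).trans (by linarith)) ?_ fun δ hδ hP => ?_
    · filter_upwards [hpos] with l hl ω
      linarith [(D.discount_mem l hl ω).2, (hU ω).1]
    · filter_upwards [hpos, hP,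
        (tendsto_const_div_nhdsGT_zero_atTop (Real.exp_pos (-b))).eventually hlim,
        (tendsto_const_div_nhdsGT_zero_atTop
          (by positivity : 0 < Real.exp (-b) + b)).eventually hlim] with l hl h3 h1 h2 ω
      have := D.discount_upper_step hU hb hb1 hε hδ hl (fun ω => (h1 ω).2) (fun ω => (h2 ω).1) h3 ω
      linarith
  · have hε : 0 < b ^ 2 / 5 := by positivity
    have hlim := eventually_bounds hV hε
    refine of_affine_contraction (P := fun δ => ∀ᶠ l in 𝓝[>] 0, ∀ ω, U ω - δ ≤ W l ω) hb hb1
      (fun x y hxy h => h.mono fun l hl ω => le_trans (by linarith) (hl ω)) ?_ fun δ hδ hP => ?_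
    · filter_upwards [hpos] with l hl ω
      linarith [(D.discount_mem l hl ω).1, (hU ω).2]
    · filter_upwards [hpos, hP, (tendsto_const_div_nhdsGT_zero_atTop one_pos).eventually hlim,
        (tendsto_const_div_nhdsGT_zero_atTop
          (by positivity : 0 < 1 + b)).eventually hlim] with l hl h3 h1 h2 ω
      have := D.discount_lower_step hU hb hb1 hε hδ hl (fun ω => (h1 ω).1) (fun ω => (h2 ω).2) h3 ω
      linarith

theorem tendstoUniformly_time (D : DynamicProgramming R V W)
    (hW : TendstoUniformly W U (𝓝[>] 0)) : TendstoUniformly V U atTop := by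
  have hU := limit_mem_Icc hW (mem_of_superset self_mem_nhdsWithin D.discount_mem)
  -- The time steps bound `V` at a fixed multiple of `S`; every large horizon is such a multiple of
  -- a large `S`.
  have rescale : ∀ {c : ℝ} {Q : ℝ → Prop}, 0 < c → (∀ᶠ S in atTop, Q (S * c)) →
      ∀ᶠ T in atTop, Q T := by
    intro c Q hc h
    filter_upwards [(tendsto_id.atTop_div_const hc).eventually h] with T hT
    simpa [div_mul_cancel₀ T hc.ne'] using hT
  refine tendstoUniformly_of_bounds (fun b hb hb1 => ?_) fun b hb hb1 => ?_
  · have hε : 0 < b ^ 2 / 5 := by positivity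
    have hlim := eventually_bounds hW hε
    refine of_affine_contraction (P := fun δ => ∀ᶠ T in atTop, ∀ ω, V T ω ≤ U ω + δ) hb hb1
      (fun x y hxy h => h.mono fun l hl ω => (hl ω).trans (by linarith)) ?_ fun δ hδ hP => ?_
    · filter_upwards [eventually_gt_atTop 0] with T hT ω
      linarith [(D.time_mem T hT ω).2, (hU ω).1]
    · refine rescale (by positivity : 0 < 1 + b) ?_
      filter_upwards [eventually_gt_atTop 0, hP,
        (tendsto_const_div_atTop_nhdsGT_zero one_pos).eventually hlim] with S hS h3 h1 ω
      have := D.time_upper_step hU hb hb1 hε hδ hS (fun ω => (h1 ω).1) (fun ω => (h1 ω).2) h3 ω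
      linarith
  · have hε : 0 < b ^ 2 / 5 := by positivity
    have hlim := eventually_bounds hW hε
    refine of_affine_contraction (P := fun δ => ∀ᶠ T in atTop, ∀ ω, U ω - δ ≤ V T ω) hb hb1
      (fun x y hxy h => h.mono fun l hl ω => le_trans (by linarith) (hl ω)) ?_ fun δ hδ hP => ?_
    · filter_upwards [eventually_gt_atTop 0] with T hT ω
      linarith [(D.time_mem T hT ω).1, (hU ω).2]
    · refine rescale (by positivity : 0 < 1 + b * Real.exp b) ?_
      filter_upwards [eventually_gt_atTop 0, hP,
        (tendsto_const_div_atTop_nhdsGT_zero (Real.exp_pos (-b))).eventually hlim] with S hS h3 h1 ω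
      have := D.time_lower_step hU hb hb1 hε hδ hS (fun ω => (h1 ω).1) (fun ω => (h1 ω).2) h3 ω
      linarith

end DynamicProgramming

/-! ### Payoff integrals and the control system -/

section Payoff

variable {f : ℝ → ℝ}

theorem integrableOn_discounted (hf : Measurable f) (h01 : ∀ t, f t ∈ Icc (0 : ℝ) 1) {l : ℝ}
    (hl : 0 < l) : IntegrableOn (fun t => Real.exp (-(l * t)) * f t) (Ioi 0) := by
  have h := exp_neg_integrableOn_Ioi 0 hl
  simp only [neg_mul] at h
  refine h.mono' (by fun_prop) (ae_of_all _ fun t => ?_)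
  rw [Real.norm_eq_abs, abs_mul, abs_of_pos (Real.exp_pos _), abs_of_nonneg (h01 t).1]
  exact mul_le_of_le_one_right (Real.exp_pos _).le (h01 t).2

theorem discounted_mem_Icc (hf : Measurable f) (h01 : ∀ t, f t ∈ Icc (0 : ℝ) 1) {l : ℝ}
    (hl : 0 < l) :
    l * ∫ t in Ioi (0 : ℝ), Real.exp (-(l * t)) * f t ∈ Icc (0 : ℝ) 1 := by
  have h := exp_neg_integrableOn_Ioi 0 hl
  have hv : ∫ t in Ioi (0 : ℝ), Real.exp (-l * t) = 1 / l := by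
    rw [integral_exp_mul_Ioi (neg_lt_zero.2 hl)]
    simp
  simp only [neg_mul] at h hv
  constructor
  · exact mul_nonneg hl.le (integral_nonneg fun t => mul_nonneg (Real.exp_pos _).le (h01 t).1)
  · have : ∫ t in Ioi (0 : ℝ), Real.exp (-(l * t)) * f t ≤ 1 / l := by
      rw [← hv]
      exact integral_mono (integrableOn_discounted hf h01 hl) h fun t =>
        mul_le_of_le_one_right (Real.exp_pos _).le (h01 t).2
    calc _ ≤ l * (1 / l) := mul_le_mul_of_nonneg_left this hl.le
      _ = 1 := by field_simp

theorem intervalIntegrable_of_mem_Icc (hf : Measurable f) (h01 : ∀ t, f t ∈ Icc (0 : ℝ) 1)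
    (a b : ℝ) : IntervalIntegrable f volume a b := by
  refine (intervalIntegrable_const (c := (1 : ℝ))).mono_fun hf.aestronglyMeasurable
    (ae_of_all _ fun t => ?_)
  simpa [abs_of_nonneg (h01 t).1] using (h01 t).2

theorem integral_mem_Icc (hf : Measurable f) (h01 : ∀ t, f t ∈ Icc (0 : ℝ) 1) {h : ℝ}
    (hh : 0 ≤ h) : ∫ t in (0 : ℝ)..h, f t ∈ Icc 0 h := by
  refine ⟨intervalIntegral.integral_nonneg hh fun t _ => (h01 t).1, ?_⟩
  calc ∫ t in (0 : ℝ)..h, f t ≤ ∫ _ in (0 : ℝ)..h, (1 : ℝ) :=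
        intervalIntegral.integral_mono_on hh (intervalIntegrable_of_mem_Icc hf h01 _ _)
          intervalIntegrable_const fun t _ => (h01 t).2
    _ = h := by simp

theorem discounted_running_bounds (hf : Measurable f) (h01 : ∀ t, f t ∈ Icc (0 : ℝ) 1) {l h : ℝ}
    (hl : 0 < l) (hh : 0 < h) :
    Real.exp (-(l * h)) * (∫ t in (0 : ℝ)..h, f t) ≤
        ∫ t in (0 : ℝ)..h, Real.exp (-(l * t)) * f t ∧
      ∫ t in (0 : ℝ)..h, Real.exp (-(l * t)) * f t ≤ ∫ t in (0 : ℝ)..h, f t := by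
  have hi := intervalIntegrable_of_mem_Icc hf h01 0 h
  have hd : IntervalIntegrable (fun t => Real.exp (-(l * t)) * f t) volume 0 h :=
    hi.continuousOn_mul (by fun_prop)
  constructor
  · rw [← intervalIntegral.integral_const_mul]
    refine intervalIntegral.integral_mono_on hh.le (hi.const_mul _) hd fun t ht =>
      mul_le_mul_of_nonneg_right (Real.exp_le_exp.2 ?_) (h01 t).1
    linarith [mul_le_mul_of_nonneg_left ht.2 hl.le]
  · refine intervalIntegral.integral_mono_on hh.le hd hi fun t ht =>
      mul_le_of_le_one_left (h01 t).1 (Real.exp_le_one_iff.2 ?_)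
    linarith [mul_nonneg hl.le ht.1]

end Payoff

theorem controlValue_apply {Ω : Type*} (K : Set (ℝ≥0 → Ω)) (c : K → ℝ) (ω : Ω) :
    controlValue K c ω = ⨆ z : feasible K ω, c z.1 := by
  simp only [controlValue, lowerValue, ciInf_const]

theorem ciSup_mem_Icc {ι : Sort*} [Nonempty ι] {c : ι → ℝ} (h : ∀ i, c i ∈ Icc (0 : ℝ) 1) :
    ⨆ i, c i ∈ Icc (0 : ℝ) 1 :=
  ⟨Real.iSup_nonneg fun i => (h i).1, ciSup_le fun i => (h i).2⟩

theorem dynamicProgramming {Ω : Type*} {K : Set (ℝ≥0 → Ω)} {g : Ω → ℝ}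
    (hg : ∀ ω, g ω ∈ Icc (0 : ℝ) 1)
    (hmeas : ∀ z ∈ K, Measurable (fun t : ℝ≥0 => g (z t)))
    (hL : ∀ ω, (feasible K ω).Nonempty)
    (hv : TimeDPP K (controlValue K) g) (hw : DiscountDPP K (controlValue K) g) :
    DynamicProgramming (reachable K g) (optTime K g) (optDiscount K g) := by
  have hne : ∀ ω, Nonempty (feasible K ω) := fun ω => (hL ω).to_subtype
  have hm : ∀ z ∈ K, Measurable (fun t : ℝ => g (z t.toNNReal)) := fun z hz =>
    (hmeas z hz).comp measurable_real_toNNReal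
  -- Negative times are clamped to 0 by `toNNReal`, so the bounds hold on all of `ℝ`.
  have h01 : ∀ z : ℝ≥0 → Ω, ∀ t : ℝ, g (z t.toNNReal) ∈ Icc (0 : ℝ) 1 := fun z t => hg _
  have hV : ∀ T, 0 < T → ∀ ω, optTime K g T ω ∈ Icc (0 : ℝ) 1 := fun T hT ω =>
    ciSup_mem_Icc fun z => by
      have := integral_mem_Icc (hm _ z.1.2) (h01 z.1.1) hT.le
      rw [timeAverage, one_div_mul_eq_div]
      exact ⟨div_nonneg this.1 hT.le, (div_le_one hT).2 this.2⟩
  have hW : ∀ l, 0 < l → ∀ ω, optDiscount K g l ω ∈ Icc (0 : ℝ) 1 := fun l hl ω =>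
    ciSup_mem_Icc fun z => discounted_mem_Icc (hm _ z.1.2) (h01 z.1.1) hl
  have eV : ∀ S h, 0 < S → 0 < h → ∀ ω, optTime K g (S + h) ω = ⨆ z : feasible K ω,
      (1 / (S + h) * (∫ t in (0 : ℝ)..h, g (z.1.1 t.toNNReal)) +
        S / (S + h) * optTime K g S (z.1.1 h.toNNReal)) := by
    intro S h hS hh ω
    have := congrFun (hv (S + h) (by positivity) h ⟨hh, by linarith⟩) ω
    simpa only [controlValue_apply, optTime, add_sub_cancel_right] using this
  have eW : ∀ l h, 0 < l → 0 < h → ∀ ω, optDiscount K g l ω = ⨆ z : feasible K ω,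
      (l * (∫ t in (0 : ℝ)..h, Real.exp (-(l * t)) * g (z.1.1 t.toNNReal)) +
        Real.exp (-(l * h)) * optDiscount K g l (z.1.1 h.toNNReal)) := by
    intro l h hl hh ω
    simpa only [controlValue_apply, optDiscount] using congrFun (hw l hl h hh) ω
  refine ⟨hV, hW, ?_, ?_, ?_, ?_⟩
  · rintro S h hS hh ω _ ⟨z, hz, h0, rfl⟩
    have hT : 0 < S + h := by positivity
    have hbdd : BddAbove (range fun z : feasible K ω =>
        1 / (S + h) * (∫ t in (0 : ℝ)..h, g (z.1.1 t.toNNReal)) +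
        S / (S + h) * optTime K g S (z.1.1 h.toNNReal)) := by
      refine ⟨1 / (S + h) * h + S / (S + h) * 1, ?_⟩
      rintro _ ⟨z, rfl⟩
      exact add_le_add
        (mul_le_mul_of_nonneg_left (integral_mem_Icc (hm _ z.1.2) (h01 z.1.1) hh.le).2
          (by positivity))
        (mul_le_mul_of_nonneg_left (hV S hS _).2 (by positivity))
    rw [eV S h hS hh ω]
    refine le_trans (le_of_eq ?_) (mul_le_mul_of_nonneg_left (le_ciSup hbdd ⟨⟨z, hz⟩, h0⟩) hT.le)
    field_simp
  · intro S h η hS hh hη ω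
    have hT : 0 < S + h := by positivity
    -- The slack is `η / (S + h)` because the inequality is then multiplied by `S + h`.
    obtain ⟨z, hz⟩ := exists_lt_of_lt_ciSup
      ((sub_lt_self _ (by positivity : 0 < η / (S + h))).trans_eq (eV S h hS hh ω))
    refine ⟨_, ⟨z.1.1, z.1.2, z.2, rfl⟩, ?_⟩
    have := mul_le_mul_of_nonneg_left hz.le hT.le
    rw [mul_sub, mul_div_cancel₀ _ hT.ne', mul_add, ← mul_assoc, ← mul_assoc,
      mul_one_div_cancel hT.ne', mul_div_cancel₀ _ hT.ne', one_mul] at this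
    exact sub_le_iff_le_add.1 this
  · rintro l h hl hh ω _ ⟨z, hz, h0, rfl⟩
    have hbdd : BddAbove (range fun z : feasible K ω =>
        l * (∫ t in (0 : ℝ)..h, Real.exp (-(l * t)) * g (z.1.1 t.toNNReal)) +
        Real.exp (-(l * h)) * optDiscount K g l (z.1.1 h.toNNReal)) := by
      refine ⟨l * h + Real.exp (-(l * h)) * 1, ?_⟩
      rintro _ ⟨z, rfl⟩
      exact add_le_add
        (mul_le_mul_of_nonneg_left ((discounted_running_bounds (hm _ z.1.2) (h01 z.1.1) hl hh).2.trans
          (integral_mem_Icc (hm _ z.1.2) (h01 z.1.1) hh.le).2) hl.le)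
        (mul_le_mul_of_nonneg_left (hW l hl _).2 (Real.exp_pos _).le)
    rw [eW l h hl hh ω]
    refine le_trans ?_ (le_ciSup hbdd ⟨⟨z, hz⟩, h0⟩)
    have := mul_le_mul_of_nonneg_left (discounted_running_bounds (hm _ hz) (h01 z) hl hh).1 hl.le
    dsimp only
    linarith
  · intro l h η hl hh hη ω
    obtain ⟨z, hz⟩ := exists_lt_of_lt_ciSup
      ((sub_lt_self _ hη).trans_eq (eW l h hl hh ω))
    refine ⟨_, ⟨z.1.1, z.1.2, z.2, rfl⟩, ?_⟩
    have := mul_le_mul_of_nonneg_left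
      (discounted_running_bounds (hm _ z.1.2) (h01 z.1.1) hl hh).2 hl.le
    dsimp only
    linarith

end AbstractControl

theorem corollary1 {Ω : Type*} [Nonempty Ω] (K : Set (ℝ≥0 → Ω)) (g : Ω → ℝ)
    (hg : ∀ ω, g ω ∈ Icc (0 : ℝ) 1)
    (hmeas : ∀ z ∈ K, Measurable (fun t : ℝ≥0 => g (z t)))
    (hL : ∀ ω, (AbstractControl.feasible K ω).Nonempty)
    (hv : AbstractControl.TimeDPP K (AbstractControl.controlValue K) g)
    (hw : AbstractControl.DiscountDPP K (AbstractControl.controlValue K) g) :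
    ((∃ U : Ω → ℝ, TendstoUniformly (AbstractControl.optTime K g) U atTop) ↔
      (∃ U : Ω → ℝ, TendstoUniformly (AbstractControl.optDiscount K g) U (𝓝[>] 0))) ∧
    (((∃ U : Ω → ℝ, TendstoUniformly (AbstractControl.optTime K g) U atTop) ∨
      (∃ U : Ω → ℝ, TendstoUniformly (AbstractControl.optDiscount K g) U (𝓝[>] 0))) →
      ∃ U : Ω → ℝ, TendstoUniformly (AbstractControl.optTime K g) U atTop ∧
        TendstoUniformly (AbstractControl.optDiscount K g) U (𝓝[>] 0)) := by
  have D := AbstractControl.dynamicProgramming hg hmeas hL hv hw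
  refine ⟨⟨fun ⟨U, h⟩ => ⟨U, D.tendstoUniformly_discount h⟩,
    fun ⟨U, h⟩ => ⟨U, D.tendstoUniformly_time h⟩⟩, ?_⟩
  rintro (⟨U, h⟩ | ⟨U, h⟩)
  · exact ⟨U, h, D.tendstoUniformly_discount h⟩
  · exact ⟨U, D.tendstoUniformly_time h, h⟩
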